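/- \textbf{Setting.} Let $1\le r$, let $\|\cdot\|_F$ be the Frobenius norm and $\|\cdot\|$ the Euclidean norm, and let $\sigma_r(X)$ be the $r$-th largest singular value of $X$. A linear map $\mathcal A:\mathbb R^{n_1\times n_2}\to\mathbb R^m$ satisfies a $k$-RIP with constant $\delta_k\in[0,1)$ if $(1-\delta_k)\|X\|_F^2\le\|\mathcal A(X)\|^2\le(1+\delta_k)\|X\|_F^2$ for all $X\in\mathbb R^{n_1\times n_2}$ of rank at most $k$. \emph{GNMR with SVD-balancing step and $\alpha=-1$}, applied to $\mathcal A$ and $b\in\mathbb R^m$ from an initialization $(U_0',V_0')\in\mathbb R^{n_1\times r}\times\mathbb R^{n_2\times r}$, does the following for $t=0,1,2,\dots$: (i) set $U_t=\bar U\Sigma^{1/2}$, $V_t=\bar V\Sigma^{1/2}$, where $U_t'V_t'^\top=\bar U\Sigma\bar V^\top$ is a singular value decomposition with $\bar U\in\mathbb R^{n_1\times r}$, $\bar V\in\mathbb R^{n_2\times r}$ having orthonormal columns and $\Sigma\in\mathbb R^{r\times r}$ diagonal with nonnegative entries; (ii) let $(\tilde U_t,\tilde V_t)$ be the minimizer of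 $(U,V)\mapsto\|\mathcal A(U_tV^\top+UV_t^\top+U_tV_t^\top)-b\|^2$ over $\mathbb R^{n_1\times r}\times\mathbb R^{n_2\times r}$ for which $\|U\|_F^2+\|V\|_F^2$ is smallest; (iii) set $U_{t+1}'=U_t+\tilde U_t$, $V_{t+1}'=V_t+\tilde V_t$. Put $X_t=U_tV_t^\top$. \textbf{Theorem (noisy matrix sensing).} Let $0<\delta<1$ and $c=7(1+\delta)^{3/2}/(1-\delta)^{3/2}$. Assume that $\mathcal A$ satisfies a $2r$-RIP with constant $\delta_{2r}\le\delta$. Let $b=\mathcal A(X^*)+\xi$, where $X^*\in\mathbb R^{n_1\times n_2}$ has rank $r$, $\sigma_r^*=\sigma_r(X^*)$, and $\xi\in\mathbb R^m$ satisfies $$\|\xi\|\le\frac{\sigma_r^*\sqrt{1-\delta}}{6c}.$$ Then, for any initialization with $\|U_0'V_0'^\top-X^*\|_F\le\sigma_r^*/c$, and for every choice of the singular value decompositions in (i), the iterates satisfy $$\|X_{t+1}-X^*\|_F\le\frac{c}{4\sigma_r^*}\,\|X_t-X^*\|_F^2+\frac{3\|\xi\|}{\sqrt{1-\delta}}\qquad\text{for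 all } t=0,1,2,\dots$$ As a result, $$\|X_t-X^*\|_F\le\frac{\sigma_r^*}{4^{2^t-1}c}+\frac{6\|\xi\|}{\sqrt{1-\delta}}\qquad\text{for all } t=0,1,2,\dots,$$ and the right-hand side tends to $6\|\xi\|/\sqrt{1-\delta}$ as $t\to\infty$. -/

import Mathlib

-- Throughout, `‖X‖` for a real matrix `X` is the Frobenius norm.
open scoped Matrix Matrix.Norms.Frobenius

noncomputable section

namespace GNMR

/-- `σᵢ(X)`, the `i`-th largest singular value of a real matrix, for `i ≥ 1`
(Mathlib's sequence of singular values starts at index `0`). -/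
def sigma {n₁ n₂ : ℕ} (i : ℕ) (X : Matrix (Fin n₁) (Fin n₂) ℝ) : ℝ :=
  (Matrix.toEuclideanLin X).singularValues (i - 1)

/-- `A` satisfies a `k`-RIP (restricted isometry property) with constant `δ ∈ [0, 1)`. -/
structure SatisfiesRIP {n₁ n₂ m : ℕ}
    (A : Matrix (Fin n₁) (Fin n₂) ℝ →ₗ[ℝ] EuclideanSpace ℝ (Fin m)) (k : ℕ) (δ : ℝ) : Prop where
  nonneg : 0 ≤ δ
  lt_one : δ < 1
  bounds : ∀ X : Matrix (Fin n₁) (Fin n₂) ℝ, X.rank ≤ k →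
    (1 - δ) * ‖X‖ ^ 2 ≤ ‖A X‖ ^ 2 ∧ ‖A X‖ ^ 2 ≤ (1 + δ) * ‖X‖ ^ 2

/-- A pair of factor matrices `Z = (U, V)`. -/
@[ext]
structure Factors (n₁ n₂ r : ℕ) where
  U : Matrix (Fin n₁) (Fin r) ℝ
  V : Matrix (Fin n₂) (Fin r) ℝ

namespace Factors

variable {n₁ n₂ r : ℕ}

/-- The matrix `U Vᵀ` represented by `(U, V)`. -/
def toMatrix (Z : Factors n₁ n₂ r) : Matrix (Fin n₁) (Fin n₂) ℝ := Z.U * Z.Vᵀ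

/-- `‖U‖_F² + ‖V‖_F²`, the squared Frobenius norm of the stacked matrix. -/
def normSq (Z : Factors n₁ n₂ r) : ℝ := ‖Z.U‖ ^ 2 + ‖Z.V‖ ^ 2

end Factors

/-- `B_err(ε)`: the factor pairs with `‖U Vᵀ - X*‖_F ≤ ε σ_r(X*)`. -/
def Berr {n₁ n₂ : ℕ} (r : ℕ) (Xstar : Matrix (Fin n₁) (Fin n₂) ℝ) (ε : ℝ) :
    Set (Factors n₁ n₂ r) :=
  {Z | ‖Z.toMatrix - Xstar‖ ≤ ε * sigma r Xstar}

/-- `Z = (Ū Σ^{1/2}, V̄ Σ^{1/2})` for some singular value decomposition `X = Ū Σ V̄ᵀ` with `r`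
columns.  The decomposition need not be unique, and no order of the diagonal entries of `Σ`
is imposed, so every possible choice is admitted. -/
def IsBalancedSVD {n₁ n₂ r : ℕ} (X : Matrix (Fin n₁) (Fin n₂) ℝ) (Z : Factors n₁ n₂ r) : Prop :=
  ∃ (Ubar : Matrix (Fin n₁) (Fin r) ℝ) (Vbar : Matrix (Fin n₂) (Fin r) ℝ) (s : Fin r → ℝ),
    Ubarᵀ * Ubar = 1 ∧ Vbarᵀ * Vbar = 1 ∧ (∀ i, 0 ≤ s i) ∧
    X = Ubar * Matrix.diagonal s * Vbarᵀ ∧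
    Z.U = Ubar * Matrix.diagonal (fun i => √(s i)) ∧
    Z.V = Vbar * Matrix.diagonal (fun i => √(s i))

section LeastSquares

variable {n₁ n₂ m r : ℕ}
  (A : Matrix (Fin n₁) (Fin n₂) ℝ →ₗ[ℝ] EuclideanSpace ℝ (Fin m))
  (b : EuclideanSpace ℝ (Fin m)) (α : ℝ)

/-- The objective `(U, V) ↦ ‖A(U_t Vᵀ + U V_tᵀ - α U_t V_tᵀ) - b‖²` at the iterate `Zt`. -/
def objective (Zt W : Factors n₁ n₂ r) : ℝ :=
  ‖A (Zt.U * W.Vᵀ + W.U * Zt.Vᵀ - α • (Zt.U * Zt.Vᵀ)) - b‖ ^ 2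

/-- `W` is a global minimizer of the least squares objective at `Zt`. -/
def IsLeastSquaresSolution (Zt W : Factors n₁ n₂ r) : Prop :=
  ∀ W' : Factors n₁ n₂ r, objective A b α Zt W ≤ objective A b α Zt W'

/-- `W` is the minimizer of smallest norm of the least squares objective at `Zt`. -/
def IsMinNormSolution (Zt W : Factors n₁ n₂ r) : Prop :=
  IsLeastSquaresSolution A b α Zt W ∧
    ∀ W' : Factors n₁ n₂ r, IsLeastSquaresSolution A b α Zt W' → W.normSq ≤ W'.normSq

/-- `Z'`, `Z`, `W` are the sequences `(U'_t, V'_t)`, `(U_t, V_t)`, `(Ũ_t, Ṽ_t)` produced by a run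
of GNMR with SVD-balancing step, variant `α`, from the initialization `Z₀`. -/
structure IsRun (Z₀ : Factors n₁ n₂ r) (Z' Z W : ℕ → Factors n₁ n₂ r) : Prop where
  init : Z' 0 = Z₀
  balance : ∀ t, IsBalancedSVD (Z' t).toMatrix (Z t)
  solve : ∀ t, IsMinNormSolution A b α (Z t) (W t)
  update_U : ∀ t, (Z' (t + 1)).U = ((1 - α) / 2) • (Z t).U + (W t).U
  update_V : ∀ t, (Z' (t + 1)).V = ((1 - α) / 2) • (Z t).V + (W t).V

end LeastSquares

end GNMR

end

/-!
Write `X = U Vᵀ` for the current balanced iterate, `M = X*`, `E = M - X`, `e = ‖E‖`, `σ = σ_r(M)`,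
`ρ = √((1 + δ) / (1 - δ))`, `η = ‖ξ‖ / √(1 - δ)`, and `L W = U W.Vᵀ + W.U Vᵀ` for the derivative of
the factorization map (`GNMR.tangent`). Then the next error is
`X' - M = (L W - T) - F + W.U W.Vᵀ`, where `T` and `F` are the tangential and the normal component
of `E = T + F`, and each of the three terms is of second order in `e`, up to noise:

* `F = (1 - P Pᵀ) E (1 - R Rᵀ)` is also the normal component of `M`. Since `M` has rank `r` and
  expands by at least `σ` on its row space, `σ ‖F‖ ≤ ‖(1 - P Pᵀ) E‖ ‖E (1 - R Rᵀ)‖`, and by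
  Pythagoras this is at most `(e² + ‖F‖²) / 2` (`Matrix.normalComponent_quadratic`).
* All singular values of `X` are at least `σ - e > 0` by Weyl's inequality
  (`Matrix.sigma_sub_le_of_svd`), so `T` is in the range of `L`. As `A (L W)` is the orthogonal
  projection of `A E + ξ` to the range of `A ∘ L`, it follows that `‖A (L W - T)‖ ≤ ‖A F + ξ‖` and
  `‖A (L W)‖ ≤ ‖A E + ξ‖`. All matrices involved have rank at most `2 r`, hence
  `‖L W - T‖ ≤ ρ ‖F‖ + η` and `‖L W‖ ≤ ρ e + η`.
* The minimality of the norm makes `W` orthogonal to the kernel of `L`, where the balancing of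
  `(U, V)` gives `(σ - e) (‖W.U‖² + ‖W.V‖²) ≤ ‖L W‖²` (`GNMR.IsMinNormSolution.mul_normSq_le`);
  so `‖W.U W.Vᵀ‖ ≤ (ρ e + η)² / (2 (σ - e))`.

`GNMR.IsMinNormSolution.step_le` collects these bounds and `GNMR.step_bound_le` compares them with
the constant `c = 7 ρ³`. The ball `e ≤ σ / c` is then invariant, and the quadratic recursion
unfolds to the doubly exponential bound (`GNMR.quadratic_recursion_bounds`).
-/

namespace Matrix

/-! ### The Frobenius norm and the trace pairing -/

section Frobenius

variable {m n k : ℕ}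

theorem frobenius_sq_eq_trace (A : Matrix (Fin m) (Fin n) ℝ) : ‖A‖ ^ 2 = (Aᵀ * A).trace := by
  rw [frobenius_norm_def, ← Real.rpow_natCast, ← Real.rpow_mul (by positivity)]
  simp only [Matrix.trace, diag_apply, mul_apply, transpose_apply]
  rw [Finset.sum_comm]
  simp [pow_two]

theorem trace_transpose_mul_comm (A B : Matrix (Fin m) (Fin n) ℝ) :
    (Aᵀ * B).trace = (Bᵀ * A).trace := by
  rw [← trace_transpose, transpose_mul, transpose_transpose]

theorem frobenius_add_sq (A B : Matrix (Fin m) (Fin n) ℝ) :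
    ‖A + B‖ ^ 2 = ‖A‖ ^ 2 + 2 * (Aᵀ * B).trace + ‖B‖ ^ 2 := by
  simp only [frobenius_sq_eq_trace, transpose_add, Matrix.add_mul, Matrix.mul_add, trace_add]
  rw [trace_transpose_mul_comm B A]
  ring

/-- `Gᵀ G = diag d` with entries at least `κ` bounds the smallest singular value of `G` below
by `√κ`. -/
theorem mul_frobenius_sq_le_of_gram_eq_diagonal {G : Matrix (Fin m) (Fin n) ℝ} {d : Fin n → ℝ}
    (hG : Gᵀ * G = diagonal d) {κ : ℝ} (hκ : ∀ i, κ ≤ d i) (Y : Matrix (Fin n) (Fin k) ℝ) :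
    κ * ‖Y‖ ^ 2 ≤ ‖G * Y‖ ^ 2 := by
  have h : (G * Y)ᵀ * (G * Y) = Yᵀ * (diagonal d * Y) := by
    rw [transpose_mul, Matrix.mul_assoc, ← Matrix.mul_assoc Gᵀ, hG]
  rw [frobenius_sq_eq_trace, frobenius_sq_eq_trace, h, ← smul_eq_mul, ← trace_smul]
  simp only [Matrix.trace, diag_apply, smul_apply, mul_apply (M := Yᵀ), transpose_apply,
    smul_eq_mul, Finset.mul_sum]
  refine Finset.sum_le_sum fun i _ => Finset.sum_le_sum fun j _ => ?_
  rw [diagonal_mul]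
  nlinarith [mul_nonneg (sub_nonneg.2 (hκ j)) (mul_self_nonneg (Y j i))]

theorem frobenius_mul_of_orthonormal {Q : Matrix (Fin m) (Fin n) ℝ} (hQ : Qᵀ * Q = 1)
    (Y : Matrix (Fin n) (Fin k) ℝ) : ‖Q * Y‖ = ‖Y‖ := by
  rw [← sq_eq_sq₀ (norm_nonneg _) (norm_nonneg _), frobenius_sq_eq_trace, frobenius_sq_eq_trace,
    transpose_mul, Matrix.mul_assoc, ← Matrix.mul_assoc Qᵀ, hQ, Matrix.one_mul]

/-- Pythagoras for the orthogonal projection `Q Qᵀ`. -/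
theorem frobenius_sq_eq_proj_add {Q : Matrix (Fin m) (Fin n) ℝ} (hQ : Qᵀ * Q = 1)
    (Y : Matrix (Fin m) (Fin k) ℝ) :
    ‖Y‖ ^ 2 = ‖Qᵀ * Y‖ ^ 2 + ‖Y - Q * (Qᵀ * Y)‖ ^ 2 := by
  have h := frobenius_add_sq (Q * (Qᵀ * Y)) (Y - Q * (Qᵀ * Y))
  have h0 : ((Q * (Qᵀ * Y))ᵀ * (Y - Q * (Qᵀ * Y))) = 0 := by
    rw [transpose_mul, Matrix.mul_assoc, Matrix.mul_sub, ← Matrix.mul_assoc Qᵀ Q, hQ,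
      Matrix.one_mul, sub_self, Matrix.mul_zero]
  rw [add_sub_cancel, h0, trace_zero, frobenius_mul_of_orthonormal hQ] at h
  linarith

theorem frobenius_transpose_mul_le {Q : Matrix (Fin m) (Fin n) ℝ} (hQ : Qᵀ * Q = 1)
    (Y : Matrix (Fin m) (Fin k) ℝ) : ‖Qᵀ * Y‖ ≤ ‖Y‖ := by
  refine le_of_sq_le_sq ?_ (norm_nonneg _)
  rw [frobenius_sq_eq_proj_add hQ Y]
  exact le_add_of_nonneg_right (sq_nonneg _)

theorem rank_add_le_add (A B : Matrix (Fin m) (Fin n) ℝ) : (A + B).rank ≤ A.rank + B.rank := by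
  unfold Matrix.rank
  rw [mulVecLin_add]
  refine (Submodule.finrank_mono (LinearMap.range_add_le _ _)).trans ?_
  exact Submodule.finrank_add_le_finrank_add_finrank _ _

theorem rank_sub_le_add (A B : Matrix (Fin m) (Fin n) ℝ) : (A - B).rank ≤ A.rank + B.rank := by
  have h : (-B).rank = B.rank := by
    unfold Matrix.rank
    rw [show (-B).mulVecLin = -B.mulVecLin by ext; simp, LinearMap.range_neg]
  rw [sub_eq_add_neg, ← h]
  exact rank_add_le_add _ _

end Frobenius

/-! ### The right singular vectors of a rank `r` matrix -/

/-- An orthonormal eigenbasis of `T* T`, in the order of the singular values. -/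
theorem _root_.LinearMap.exists_rightSingularBasis {n₁ n₂ : ℕ}
    (T : EuclideanSpace ℝ (Fin n₂) →ₗ[ℝ] EuclideanSpace ℝ (Fin n₁)) :
    ∃ v : OrthonormalBasis (Fin n₂) ℝ (EuclideanSpace ℝ (Fin n₂)), ∀ i j,
      inner ℝ (T (v i)) (T (v j)) = if i = j then T.singularValues i ^ 2 else 0 := by
  have hn : Module.finrank ℝ (EuclideanSpace ℝ (Fin n₂)) = n₂ := finrank_euclideanSpace_fin
  refine ⟨T.isSymmetric_adjoint_comp_self.eigenvectorBasis hn, fun i j => ?_⟩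
  rw [← LinearMap.adjoint_inner_right, ← LinearMap.comp_apply,
    LinearMap.IsSymmetric.apply_eigenvectorBasis, inner_smul_right,
    ← T.sq_singularValues_fin hn j, orthonormal_iff_ite.1 (OrthonormalBasis.orthonormal _)]
  split_ifs with h
  · rw [h, mul_one]; rfl
  · rw [mul_zero]

theorem finrank_range_toEuclideanLin {n₁ n₂ : ℕ} (M : Matrix (Fin n₁) (Fin n₂) ℝ) :
    Module.finrank ℝ (toEuclideanLin M).range = M.rank := by
  rw [M.rank_eq_finrank_range_toLin (EuclideanSpace.basisFun (Fin n₁) ℝ).toBasis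
      (EuclideanSpace.basisFun (Fin n₂) ℝ).toBasis, toEuclideanLin_eq_toLin_orthonormal]

open GNMR in
/-- Right singular vectors to the nonzero singular values: an orthonormal basis `Q` of the row
space, on which `M` expands by at least `σ_r(M)`. -/
theorem exists_rowSpace_basis {n₁ n₂ r : ℕ} (M : Matrix (Fin n₁) (Fin n₂) ℝ) (hM : M.rank = r) :
    ∃ Q : Matrix (Fin n₂) (Fin r) ℝ, Qᵀ * Q = 1 ∧ M * Q * Qᵀ = M ∧
      ∀ {k : ℕ} (Y : Matrix (Fin r) (Fin k) ℝ), sigma r M * ‖Y‖ ≤ ‖M * Q * Y‖ := by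
  have hrn : r ≤ n₂ := hM ▸ M.rank_le_width
  set T := toEuclideanLin M with hT
  have hrange : Module.finrank ℝ T.range = r := hM ▸ finrank_range_toEuclideanLin M
  obtain ⟨v, hTv⟩ := T.exists_rightSingularBasis
  let Q : Matrix (Fin n₂) (Fin r) ℝ := of fun a i => v (Fin.castLE hrn i) a
  have hMQ : ∀ a i, (M * Q) a i = T (v (Fin.castLE hrn i)) a := fun a i => rfl
  refine ⟨Q, ?_, ?_, ?_⟩
  · ext i j
    have h := orthonormal_iff_ite.1 v.orthonormal (Fin.castLE hrn i) (Fin.castLE hrn j)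
    rw [PiLp.inner_apply] at h
    simp only [Fin.castLE_inj] at h
    rw [one_apply, ← h]
    simp [mul_apply, Q, mul_comm]
  · have hzero : ∀ i : Fin n₂, r ≤ i → T (v i) = 0 := by
      intro i hi
      have h := hTv i i
      rw [if_pos rfl, T.singularValues_eq_zero_iff_le_finrank_range.2 (hrange.trans_le hi)] at h
      simpa using h
    ext a b
    have hb := congrArg (fun x => T x a) (v.sum_repr (EuclideanSpace.single b (1 : ℝ)))
    simp only [map_sum, map_smul] at hb
    have hMab : T (EuclideanSpace.single b (1 : ℝ)) a = M a b := by
      simp [hT, toLpLin_apply]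
    rw [hMab] at hb
    rw [← hb, mul_apply, WithLp.ofLp_sum, Finset.sum_apply]
    refine Fintype.sum_of_injective (Fin.castLE hrn) (Fin.castLE_injective hrn) _ _ ?_ ?_
    · intro i hi
      have : r ≤ i := by
        by_contra! h
        exact hi ⟨⟨i, h⟩, rfl⟩
      simp [hzero i this]
    · intro i
      rw [hMQ]
      simp [OrthonormalBasis.repr_apply_apply, EuclideanSpace.inner_single_right, Q, mul_comm]
  · intro k Y
    have hgram : (M * Q)ᵀ * (M * Q) =
        diagonal fun i : Fin r => T.singularValues (i : ℕ) ^ 2 := by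
      ext i j
      have h := hTv (Fin.castLE hrn i) (Fin.castLE hrn j)
      rw [PiLp.inner_apply] at h
      simp only [Fin.castLE_inj, Fin.val_castLE] at h
      rw [diagonal_apply, ← h, mul_apply]
      refine Finset.sum_congr rfl fun a _ => ?_
      rw [transpose_apply, hMQ, hMQ]
      simp [mul_comm]
    refine le_of_sq_le_sq ?_ (norm_nonneg _)
    rw [mul_pow]
    refine mul_frobenius_sq_le_of_gram_eq_diagonal hgram (fun i => ?_) Y
    exact pow_le_pow_left₀ (T.singularValues_nonneg _)
      (T.singularValues_antitone (Nat.le_pred_of_lt i.2)) 2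

theorem sigma_pos {n₁ n₂ r : ℕ} (hr : 1 ≤ r) {M : Matrix (Fin n₁) (Fin n₂) ℝ} (hM : M.rank = r) :
    0 < GNMR.sigma r M := by
  refine (LinearMap.singularValues_pos_iff_lt_finrank_range _).2 ?_
  rw [finrank_range_toEuclideanLin]
  omega

open GNMR in
/-- Weyl's inequality for the smallest diagonal entry of an `r`-column singular value
decomposition of a perturbation of the rank `r` matrix `M`. -/
theorem sigma_sub_le_of_svd {n₁ n₂ r : ℕ} {M : Matrix (Fin n₁) (Fin n₂) ℝ} (hM : M.rank = r)
    {P : Matrix (Fin n₁) (Fin r) ℝ} {R : Matrix (Fin n₂) (Fin r) ℝ} {s : Fin r → ℝ}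
    (hP : Pᵀ * P = 1) (hR : Rᵀ * R = 1) (hs : ∀ i, 0 ≤ s i) (j : Fin r) :
    sigma r M - ‖P * diagonal s * Rᵀ - M‖ ≤ s j := by
  obtain ⟨Q, hQ, -, hexp⟩ := exists_rowSpace_basis M hM
  set e := ‖P * diagonal s * Rᵀ - M‖ with he
  by_cases hpos : sigma r M - e ≤ 0
  · exact hpos.trans (hs j)
  push Not at hpos
  have key : ∀ {k : ℕ} (Y : Matrix (Fin r) (Fin k) ℝ),
      (sigma r M - e) * ‖Y‖ ≤ ‖diagonal s * (Rᵀ * Q * Y)‖ := by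
    intro k Y
    have h1 : M * Q * Y = P * (diagonal s * (Rᵀ * Q * Y)) -
        (P * diagonal s * Rᵀ - M) * (Q * Y) := by
      simp only [Matrix.sub_mul, Matrix.mul_assoc]
      abel
    have h2 := norm_sub_le (P * (diagonal s * (Rᵀ * Q * Y)))
      ((P * diagonal s * Rᵀ - M) * (Q * Y))
    have h3 := frobenius_norm_mul (P * diagonal s * Rᵀ - M) (Q * Y)
    rw [← h1, frobenius_mul_of_orthonormal hP] at h2
    rw [frobenius_mul_of_orthonormal hQ Y] at h3
    linarith [hexp Y]
  have hinv : IsUnit (Rᵀ * Q).det := by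
    rw [isUnit_iff_ne_zero]
    intro h0
    obtain ⟨z, hz, hz0⟩ := exists_mulVec_eq_zero_iff.2 h0
    have h := key (replicateCol (Fin 1) z)
    rw [← replicateCol_mulVec, hz0, replicateCol_zero, Matrix.mul_zero, norm_zero] at h
    have : 0 < ‖replicateCol (Fin 1) z‖ := by
      rw [norm_pos_iff]
      simpa using hz
    nlinarith
  -- Test on the preimage of the `j`-th unit vector `E` under the invertible contraction `Rᵀ Q`.
  set E : Matrix (Fin r) (Fin 1) ℝ := replicateCol (Fin 1) (Pi.single j 1) with hE
  have hE1 : ‖E‖ = 1 := by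
    refine (frobenius_norm_replicateCol (ι := Fin 1) (Pi.single j (1 : ℝ))).trans ?_
    simp
  have hsE : ‖diagonal s * E‖ = s j := by
    have : diagonal s * E = s j • E := by
      ext a b
      by_cases h : a = j
      · subst h; simp [hE, diagonal_mul]
      · simp [hE, diagonal_mul, h]
    rw [this, norm_smul, hE1, mul_one, Real.norm_of_nonneg (hs j)]
  have h1 := key ((Rᵀ * Q)⁻¹ * E)
  have h2 := frobenius_transpose_mul_le hR (Q * ((Rᵀ * Q)⁻¹ * E))
  rw [frobenius_mul_of_orthonormal hQ, ← Matrix.mul_assoc, ← Matrix.mul_assoc,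
    mul_nonsing_inv _ hinv, Matrix.one_mul, hE1] at h2
  rw [← Matrix.mul_assoc (Rᵀ * Q), mul_nonsing_inv _ hinv, Matrix.one_mul, hsE] at h1
  nlinarith

end Matrix

namespace Matrix

/-! ### The normal component of the error is of second order -/

section Normal

variable {m n k : ℕ}

theorem frobenius_mul_le_of_orthonormal {Q : Matrix (Fin n) (Fin k) ℝ} (hQ : Qᵀ * Q = 1)
    (Y : Matrix (Fin m) (Fin n) ℝ) : ‖Y * Q‖ ≤ ‖Y‖ := by
  have h := frobenius_transpose_mul_le hQ Yᵀ
  rwa [← transpose_mul, frobenius_norm_transpose, frobenius_norm_transpose] at h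

theorem frobenius_sub_mul_proj_le {R : Matrix (Fin n) (Fin k) ℝ} (hR : Rᵀ * R = 1)
    (Y : Matrix (Fin m) (Fin n) ℝ) : ‖Y - Y * R * Rᵀ‖ ≤ ‖Y‖ := by
  have h := frobenius_sq_eq_proj_add hR Yᵀ
  rw [← frobenius_norm_transpose (Y - Y * R * Rᵀ), ← frobenius_norm_transpose Y]
  refine le_of_sq_le_sq ?_ (norm_nonneg _)
  rw [h, transpose_sub, transpose_mul, transpose_mul, transpose_transpose]
  exact le_add_of_nonneg_left (sq_nonneg _)

/-- The component `(1 - P Pᵀ) Y (1 - R Rᵀ)` of `Y` that is orthogonal to the tangent space, at a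
matrix with column space spanned by `P` and row space spanned by `R`, of the matrices of
that rank. -/
def normalComponent (P : Matrix (Fin m) (Fin k) ℝ) (R : Matrix (Fin n) (Fin k) ℝ)
    (Y : Matrix (Fin m) (Fin n) ℝ) : Matrix (Fin m) (Fin n) ℝ :=
  (Y - P * (Pᵀ * Y)) - (Y - P * (Pᵀ * Y)) * R * Rᵀ

theorem normalComponent_eq_mul (P : Matrix (Fin m) (Fin k) ℝ) (R : Matrix (Fin n) (Fin k) ℝ)
    (Y : Matrix (Fin m) (Fin n) ℝ) :
    normalComponent P R Y = (1 - P * Pᵀ) * Y * (1 - R * Rᵀ) := by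
  simp only [normalComponent, Matrix.sub_mul, Matrix.mul_sub, Matrix.mul_assoc, Matrix.one_mul,
    Matrix.mul_one]

theorem sub_proj_eq_of_sub_svd {P : Matrix (Fin m) (Fin k) ℝ} (hP : Pᵀ * P = 1)
    (B : Matrix (Fin k) (Fin n) ℝ) (Y : Matrix (Fin m) (Fin n) ℝ) :
    (Y - P * B) - P * (Pᵀ * (Y - P * B)) = Y - P * (Pᵀ * Y) := by
  rw [Matrix.mul_sub, ← Matrix.mul_assoc Pᵀ P, hP, Matrix.one_mul, Matrix.mul_sub]
  abel

theorem rank_normalComponent_le (P : Matrix (Fin m) (Fin k) ℝ) (R : Matrix (Fin n) (Fin k) ℝ)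
    (Y : Matrix (Fin m) (Fin n) ℝ) : (normalComponent P R Y).rank ≤ Y.rank := by
  rw [normalComponent_eq_mul]
  exact (rank_mul_le_left _ _).trans (rank_mul_le_right _ _)

theorem normalComponent_norm_le {P : Matrix (Fin m) (Fin k) ℝ} {R : Matrix (Fin n) (Fin k) ℝ}
    (hP : Pᵀ * P = 1) (hR : Rᵀ * R = 1) (Y : Matrix (Fin m) (Fin n) ℝ) :
    ‖normalComponent P R Y‖ ≤ ‖Y‖ := by
  refine (frobenius_sub_mul_proj_le hR _).trans (le_of_sq_le_sq ?_ (norm_nonneg _))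
  rw [frobenius_sq_eq_proj_add hP Y]
  exact le_add_of_nonneg_left (sq_nonneg _)

/-- Replacing a rank `k` matrix `M` by the error `M - P D Rᵀ` does not change the normal
component, and that component is quadratic in the error: `M` factors through its row space, where
it expands by at least `σ_k(M)`, so `(1 - P Pᵀ) M (1 - R Rᵀ)` is at most the product of its two
one-sided parts, divided by `σ_k(M)`. -/
theorem normalComponent_quadratic {M : Matrix (Fin m) (Fin n) ℝ} (hM : M.rank = k)
    {P : Matrix (Fin m) (Fin k) ℝ} {R : Matrix (Fin n) (Fin k) ℝ} (D : Matrix (Fin k) (Fin k) ℝ)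
    (hP : Pᵀ * P = 1) (hR : Rᵀ * R = 1) :
    normalComponent P R (M - P * D * Rᵀ) = normalComponent P R M ∧
    2 * GNMR.sigma k M * ‖normalComponent P R M‖ ≤
      ‖M - P * D * Rᵀ‖ ^ 2 + ‖normalComponent P R M‖ ^ 2 := by
  obtain ⟨Q, hQ, hMQ, hexp⟩ := exists_rowSpace_basis M hM
  set E := M - P * D * Rᵀ with hE
  have hN : E - P * (Pᵀ * E) = M - P * (Pᵀ * M) := by
    rw [hE, Matrix.mul_assoc P D]
    exact sub_proj_eq_of_sub_svd hP _ M
  have hC : E - E * R * Rᵀ = M - M * R * Rᵀ := by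
    rw [hE, Matrix.sub_mul, Matrix.sub_mul, Matrix.mul_assoc (P * D), hR, Matrix.mul_one]
    abel
  refine ⟨by simp only [normalComponent, hN], ?_⟩
  set F := normalComponent P R M with hF
  -- The two one-sided parts; they are the same for `E` as for `M`.
  set N := M - P * (Pᵀ * M) with hNdef
  set C := M - M * R * Rᵀ with hCdef
  have hab : ‖N‖ ^ 2 + ‖C‖ ^ 2 ≤ ‖E‖ ^ 2 + ‖F‖ ^ 2 := by
    have h1 := frobenius_sq_eq_proj_add hP E
    have h2 := frobenius_sq_eq_proj_add hP C
    have h3 := frobenius_sub_mul_proj_le hR (Pᵀ * E)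
    have h4 : Pᵀ * E - Pᵀ * E * R * Rᵀ = Pᵀ * C := by
      rw [← hC, Matrix.mul_sub Pᵀ E, Matrix.mul_assoc E, ← Matrix.mul_assoc Pᵀ E,
        Matrix.mul_assoc (Pᵀ * E)]
    have h5 : C - P * (Pᵀ * C) = F := by
      rw [hF, normalComponent_eq_mul, hCdef]
      simp only [Matrix.sub_mul, Matrix.mul_sub, Matrix.mul_assoc, Matrix.one_mul, Matrix.mul_one]
      abel
    rw [h4] at h3
    rw [h5] at h2
    rw [hN] at h1
    have := pow_le_pow_left₀ (norm_nonneg _) h3 2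
    linarith
  have hNQ : N * Q * Qᵀ = N := by
    rw [hNdef, Matrix.sub_mul, Matrix.sub_mul, hMQ]
    simp only [Matrix.mul_assoc]
    rw [← Matrix.mul_assoc M, hMQ]
  have hfac : ∀ Y : Matrix (Fin m) (Fin n) ℝ, Y * Q * Qᵀ = Y →
      Y - Y * R * Rᵀ = Y * Q * (Qᵀ - Qᵀ * R * Rᵀ) := fun Y hY => by
    rw [Matrix.mul_sub, hY, Matrix.mul_assoc Qᵀ, ← Matrix.mul_assoc (Y * Q), hY,
      ← Matrix.mul_assoc]
  have hFN : F = N * Q * (Qᵀ - Qᵀ * R * Rᵀ) := hfac N hNQ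
  have hCQ : C = M * Q * (Qᵀ - Qᵀ * R * Rᵀ) := hfac M hMQ
  have h1 := hexp (Qᵀ - Qᵀ * R * Rᵀ)
  rw [← hCQ] at h1
  have h2 := frobenius_norm_mul (N * Q) (Qᵀ - Qᵀ * R * Rᵀ)
  rw [← hFN] at h2
  have h3 := frobenius_mul_le_of_orthonormal hQ N
  set y := ‖Qᵀ - Qᵀ * R * Rᵀ‖
  have hy : 0 ≤ y := norm_nonneg _
  have hσ : 0 ≤ GNMR.sigma k M := LinearMap.singularValues_nonneg _ _
  have h4 : GNMR.sigma k M * ‖F‖ ≤ ‖N‖ * ‖C‖ := calc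
    GNMR.sigma k M * ‖F‖ ≤ GNMR.sigma k M * (‖N‖ * y) := by
      gcongr
      exact h2.trans (by gcongr)
    _ = ‖N‖ * (GNMR.sigma k M * y) := by ring
    _ ≤ ‖N‖ * ‖C‖ := by gcongr
  nlinarith [sq_nonneg (‖N‖ - ‖C‖)]

end Normal

end Matrix

/-! ### First-order conditions for minimizers -/

theorem eq_zero_of_forall_quadratic_nonneg {x y : ℝ} (h : ∀ t : ℝ, 0 ≤ 2 * t * x + t ^ 2 * y) :
    x = 0 := by
  have hd := discrim_le_zero (a := y) (b := 2 * x) (c := 0) fun t => by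
    linarith [h t]
  rw [discrim] at hd
  nlinarith [sq_nonneg x]

/-- The least squares fit `p` of `y` along a line through `q`: by Pythagoras its distance from
`q` is at most the residual of `q`. -/
theorem norm_sub_le_of_forall_line {H : Type*} [NormedAddCommGroup H] [InnerProductSpace ℝ H]
    {p q y : H} (h : ∀ t : ℝ, ‖p - y‖ ^ 2 ≤ ‖p + t • (q - p) - y‖ ^ 2) : ‖p - q‖ ≤ ‖q - y‖ := by
  have h0 : inner ℝ (p - y) (q - p) = 0 := by
    refine eq_zero_of_forall_quadratic_nonneg (y := ‖q - p‖ ^ 2) fun t => ?_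
    have ht := h t
    rw [show p + t • (q - p) - y = (p - y) + t • (q - p) by abel, norm_add_sq_real,
      inner_smul_right, norm_smul, mul_pow, Real.norm_eq_abs, sq_abs] at ht
    linarith
  refine le_of_sq_le_sq ?_ (norm_nonneg _)
  rw [show q - y = (p - y) + (q - p) by abel, norm_add_sq_real, h0, norm_sub_rev p q]
  nlinarith [sq_nonneg ‖p - y‖]

namespace GNMR

open Matrix

variable {n₁ n₂ m r : ℕ}

/-- The derivative `(U', V') ↦ U V'ᵀ + U' Vᵀ` of `(U, V) ↦ U Vᵀ` at `Z = (U, V)`. -/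
def tangent (Z W : Factors n₁ n₂ r) : Matrix (Fin n₁) (Fin n₂) ℝ := Z.U * W.Vᵀ + W.U * Z.Vᵀ

theorem rank_tangent_le (Z W : Factors n₁ n₂ r) : (tangent Z W).rank ≤ 2 * r := by
  refine (rank_add_le_add _ _).trans ?_
  have h1 := (rank_mul_le_left Z.U W.Vᵀ).trans Z.U.rank_le_width
  have h2 := (rank_mul_le_left W.U Z.Vᵀ).trans W.U.rank_le_width
  omega

theorem rank_toMatrix_le (Z : Factors n₁ n₂ r) : Z.toMatrix.rank ≤ r :=
  (rank_mul_le_left Z.U Z.Vᵀ).trans Z.U.rank_le_width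

theorem objective_neg_one (A : Matrix (Fin n₁) (Fin n₂) ℝ →ₗ[ℝ] EuclideanSpace ℝ (Fin m))
    (b : EuclideanSpace ℝ (Fin m)) (Z W : Factors n₁ n₂ r) :
    objective A b (-1) Z W = ‖A (tangent Z W) - (b - A Z.toMatrix)‖ ^ 2 := by
  rw [objective, neg_one_smul, sub_neg_eq_add, map_add, sub_sub_eq_add_sub]
  rfl

theorem IsLeastSquaresSolution.norm_sub_le
    {A : Matrix (Fin n₁) (Fin n₂) ℝ →ₗ[ℝ] EuclideanSpace ℝ (Fin m)}
    {b : EuclideanSpace ℝ (Fin m)} {Z W : Factors n₁ n₂ r}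
    (hW : IsLeastSquaresSolution A b (-1) Z W) (W' : Factors n₁ n₂ r) :
    ‖A (tangent Z W) - A (tangent Z W')‖ ≤ ‖A (tangent Z W') - (b - A Z.toMatrix)‖ := by
  refine norm_sub_le_of_forall_line fun t => ?_
  have h := hW ⟨W.U + t • (W'.U - W.U), W.V + t • (W'.V - W.V)⟩
  have hline : tangent Z ⟨W.U + t • (W'.U - W.U), W.V + t • (W'.V - W.V)⟩ =
      tangent Z W + t • (tangent Z W' - tangent Z W) := by
    simp only [tangent, transpose_add, transpose_smul, transpose_sub, Matrix.mul_add,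
      Matrix.add_mul, Matrix.mul_smul, Matrix.smul_mul, Matrix.mul_sub, Matrix.sub_mul]
    module
  rwa [objective_neg_one, objective_neg_one, hline, map_add, map_smul, map_sub] at h

/-- The least squares objective does not change along `(U K, -V Kᵀ)`, the kernel of the tangent
map, so the solution of least norm is orthogonal to these directions. Testing with
`K = Uᵀ W.U` shows that the
inner product of the two terms of `tangent Z W` is `‖K‖²`. -/
theorem IsMinNormSolution.trace_nonneg
    {A : Matrix (Fin n₁) (Fin n₂) ℝ →ₗ[ℝ] EuclideanSpace ℝ (Fin m)}
    {b : EuclideanSpace ℝ (Fin m)} {α : ℝ} {Z W : Factors n₁ n₂ r}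
    (hW : IsMinNormSolution A b α Z W) :
    0 ≤ ((Z.U * W.Vᵀ)ᵀ * (W.U * Z.Vᵀ)).trace := by
  set K := Z.Uᵀ * W.U with hK
  have h0 : (W.Uᵀ * (Z.U * K)).trace - (W.Vᵀ * (Z.V * Kᵀ)).trace = 0 := by
    refine eq_zero_of_forall_quadratic_nonneg (y := ‖Z.U * K‖ ^ 2 + ‖Z.V * Kᵀ‖ ^ 2) fun t => ?_
    have h := hW.2 ⟨W.U + t • (Z.U * K), W.V + (-t) • (Z.V * Kᵀ)⟩ fun W' => by
      refine le_of_eq_of_le ?_ (hW.1 W')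
      have : Z.U * (W.V + (-t) • (Z.V * Kᵀ))ᵀ + (W.U + t • (Z.U * K)) * Z.Vᵀ =
          Z.U * W.Vᵀ + W.U * Z.Vᵀ := by
        simp only [transpose_add, transpose_smul, transpose_mul, transpose_transpose,
          Matrix.mul_add, Matrix.add_mul, Matrix.mul_smul, Matrix.smul_mul, Matrix.mul_assoc]
        module
      simp only [objective, this]
    simp only [Factors.normSq, frobenius_add_sq, Matrix.mul_smul, trace_smul, norm_smul, mul_pow,
      Real.norm_eq_abs, sq_abs, smul_eq_mul] at h
    nlinarith
  have h1 : (W.Uᵀ * (Z.U * K)).trace = ‖K‖ ^ 2 := by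
    rw [frobenius_sq_eq_trace, ← Matrix.mul_assoc, hK, transpose_mul, transpose_transpose]
  have h2 : ((Z.U * W.Vᵀ)ᵀ * (W.U * Z.Vᵀ)).trace = (W.Vᵀ * (Z.V * Kᵀ)).trace := by
    rw [← trace_transpose, hK]
    simp only [transpose_mul, transpose_transpose]
    rw [← Matrix.mul_assoc, trace_mul_comm]
    simp only [Matrix.mul_assoc]
  rw [h2, ← sub_eq_zero.1 h0, h1]
  positivity

theorem gram_mul_diagonal_sqrt {n : ℕ} {P : Matrix (Fin n) (Fin r) ℝ} (hP : Pᵀ * P = 1)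
    {s : Fin r → ℝ} (hs : ∀ i, 0 ≤ s i) :
    (P * diagonal fun i => √(s i))ᵀ * (P * diagonal fun i => √(s i)) = diagonal s := by
  rw [transpose_mul, Matrix.mul_assoc, ← Matrix.mul_assoc Pᵀ, hP, Matrix.one_mul,
    diagonal_transpose, diagonal_mul_diagonal]
  simp [Real.mul_self_sqrt (hs _)]

/-- On least-norm solutions the tangent map at a balanced pair expands by at least the square root
of the smallest singular value. -/
theorem IsMinNormSolution.mul_normSq_le
    {A : Matrix (Fin n₁) (Fin n₂) ℝ →ₗ[ℝ] EuclideanSpace ℝ (Fin m)}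
    {b : EuclideanSpace ℝ (Fin m)} {α : ℝ} {Z W : Factors n₁ n₂ r}
    (hW : IsMinNormSolution A b α Z W) {s : Fin r → ℝ} {κ : ℝ} (hκ : ∀ i, κ ≤ s i)
    (hU : Z.Uᵀ * Z.U = diagonal s) (hV : Z.Vᵀ * Z.V = diagonal s) :
    κ * W.normSq ≤ ‖tangent Z W‖ ^ 2 := by
  have h1 := mul_frobenius_sq_le_of_gram_eq_diagonal hU hκ W.Vᵀ
  have h2 := mul_frobenius_sq_le_of_gram_eq_diagonal hV hκ W.Uᵀ
  have h3 : ‖W.U * Z.Vᵀ‖ = ‖Z.V * W.Uᵀ‖ := by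
    rw [← frobenius_norm_transpose, transpose_mul, transpose_transpose]
  rw [frobenius_norm_transpose] at h1 h2
  rw [tangent, frobenius_add_sq, Factors.normSq, h3]
  linarith [hW.trace_nonneg]

theorem IsBalancedSVD.toMatrix_eq {X : Matrix (Fin n₁) (Fin n₂) ℝ} {Z : Factors n₁ n₂ r}
    (h : IsBalancedSVD X Z) : Z.toMatrix = X := by
  obtain ⟨P, R, s, -, -, hs, hX, hU, hV⟩ := h
  have hd : diagonal s = diagonal (fun i => √(s i)) * diagonal (fun i => √(s i)) := by
    rw [diagonal_mul_diagonal]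
    simp [Real.mul_self_sqrt (hs _)]
  rw [Factors.toMatrix, hU, hV, hX, hd, transpose_mul, diagonal_transpose]
  simp only [Matrix.mul_assoc]

/-! ### One step of the iteration -/

/-- Restricted isometry turns the least squares estimates into estimates for `tangent Z W`: its
size is bounded by the error, its distance from the tangential part of the error by the
normal component `F`, and the remaining term `W.U W.Vᵀ` is of second order by the minimality of
the norm. -/
theorem IsMinNormSolution.step_le
    {A : Matrix (Fin n₁) (Fin n₂) ℝ →ₗ[ℝ] EuclideanSpace ℝ (Fin m)} {ρ μ : ℝ} (hμ : 0 < μ)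
    (hlo : ∀ N : Matrix (Fin n₁) (Fin n₂) ℝ, N.rank ≤ 2 * r → μ * ‖N‖ ≤ ‖A N‖)
    (hhi : ∀ N : Matrix (Fin n₁) (Fin n₂) ℝ, N.rank ≤ 2 * r → ‖A N‖ ≤ ρ * μ * ‖N‖)
    {M : Matrix (Fin n₁) (Fin n₂) ℝ} (hM : M.rank = r) {ξ : EuclideanSpace ℝ (Fin m)}
    {X : Matrix (Fin n₁) (Fin n₂) ℝ} {Z W : Factors n₁ n₂ r} (hZ : IsBalancedSVD X Z)
    (hX : ‖X - M‖ < sigma r M) (hW : IsMinNormSolution A (A M + ξ) (-1) Z W) :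
    ∃ f : ℝ, 0 ≤ f ∧ f ≤ ‖X - M‖ ∧ 2 * sigma r M * f ≤ ‖X - M‖ ^ 2 + f ^ 2 ∧
      ‖(Z.U + W.U) * (Z.V + W.V)ᵀ - M‖ ≤ (1 + ρ) * f + ‖ξ‖ / μ +
        (ρ * ‖X - M‖ + ‖ξ‖ / μ) ^ 2 / (2 * (sigma r M - ‖X - M‖)) := by
  have hZX := hZ.toMatrix_eq
  have hrX : X.rank ≤ r := hZX ▸ rank_toMatrix_le Z
  obtain ⟨P, R, s, hP, hR, hs, hsvd, hU, hV⟩ := hZ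
  have hweyl : ∀ j, sigma r M - ‖X - M‖ ≤ s j := fun j => by
    rw [hsvd]; exact sigma_sub_le_of_svd hM hP hR hs j
  have hs0 : ∀ j, √(s j) ≠ 0 := fun j =>
    (Real.sqrt_pos.2 (lt_of_lt_of_le (sub_pos.2 hX) (hweyl j))).ne'
  set e := ‖X - M‖ with he
  have hgU : Z.Uᵀ * Z.U = diagonal s := by rw [hU]; exact gram_mul_diagonal_sqrt hP hs
  have hgV : Z.Vᵀ * Z.V = diagonal s := by rw [hV]; exact gram_mul_diagonal_sqrt hR hs
  obtain ⟨hF, hFq⟩ := normalComponent_quadratic hM (diagonal s) hP hR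
  have hFle := normalComponent_norm_le hP hR (M - P * diagonal s * Rᵀ)
  rw [hF] at hFle
  rw [← hsvd] at hF hFq hFle
  rw [norm_sub_rev, ← he] at hFq hFle
  refine ⟨‖normalComponent P R M‖, norm_nonneg _, hFle, hFq, ?_⟩
  set F := normalComponent P R M with hFdef
  have hrF : F.rank ≤ 2 * r := (rank_normalComponent_le P R M).trans (by omega)
  -- A preimage of the tangential part of the error `M - X` under the tangent map.
  obtain ⟨G, hGdef⟩ : ∃ G, G = M - X := ⟨_, rfl⟩
  rw [← hGdef] at hF
  let W' : Factors n₁ n₂ r :=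
    ⟨(G - P * (Pᵀ * G)) * R * diagonal fun i => (√(s i))⁻¹,
      (diagonal (fun i => (√(s i))⁻¹) * (Pᵀ * G))ᵀ⟩
  have hW' : tangent Z W' = G - F := by
    have hd1 : diagonal (fun i => √(s i)) * diagonal (fun i => (√(s i))⁻¹) = 1 := by
      simp [diagonal_mul_diagonal, mul_inv_cancel₀ (hs0 _)]
    have hd2 : diagonal (fun i => (√(s i))⁻¹) * diagonal (fun i => √(s i)) = 1 := by
      simp [diagonal_mul_diagonal, inv_mul_cancel₀ (hs0 _)]
    have h1 : Z.U * W'.Vᵀ = P * (Pᵀ * G) := by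
      rw [hU, transpose_transpose, Matrix.mul_assoc, ← Matrix.mul_assoc (diagonal _), hd1,
        Matrix.one_mul]
    have h2 : W'.U * Z.Vᵀ = (G - P * (Pᵀ * G)) * R * Rᵀ := by
      rw [hV, transpose_mul, diagonal_transpose, Matrix.mul_assoc, ← Matrix.mul_assoc (diagonal _),
        hd2, Matrix.one_mul]
    rw [tangent, h1, h2, ← hF, normalComponent]
    abel
  have hb : A M + ξ - A Z.toMatrix = A G + ξ := by
    rw [hZX, hGdef, map_sub]; abel
  have hG : ‖G‖ = e := by rw [hGdef, norm_sub_rev]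
  have hrG : G.rank ≤ 2 * r := hGdef ▸ (rank_sub_le_add _ _).trans (by omega)
  -- `‖L W‖ ≤ ρ e + η` by comparison with the zero pair.
  have hLW : ‖tangent Z W‖ ≤ ρ * e + ‖ξ‖ / μ := by
    have h1 := hW.1.norm_sub_le ⟨0, 0⟩
    rw [show tangent Z ⟨0, 0⟩ = 0 by simp [tangent], map_zero, sub_zero, zero_sub, norm_neg,
      hb] at h1
    have h2 := hlo _ (rank_tangent_le Z W)
    have h3 := hhi G hrG
    rw [hG] at h3
    have h4 := norm_add_le (A G) ξ
    rw [← mul_le_mul_iff_right₀ hμ, mul_add, mul_div_cancel₀ _ hμ.ne']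
    linarith
  have hdiff : ‖tangent Z W - (G - F)‖ ≤ ρ * ‖F‖ + ‖ξ‖ / μ := by
    have h1 := hW.1.norm_sub_le W'
    rw [hb, ← map_sub, hW', map_sub A G F,
      show A G - A F - (A G + ξ) = -(A F + ξ) by abel, norm_neg] at h1
    have hr : (tangent Z W - (G - F)).rank ≤ 2 * r := by
      have : tangent Z W - (G - F) = tangent Z ⟨W.U - W'.U, W.V - W'.V⟩ := by
        rw [← hW']
        simp only [tangent, transpose_sub, Matrix.mul_sub, Matrix.sub_mul]
        abel
      rw [this]
      exact rank_tangent_le _ _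
    have h2 := hlo _ hr
    have h3 := hhi F hrF
    have h4 := norm_add_le (A F) ξ
    rw [← mul_le_mul_iff_right₀ hμ, mul_add, mul_div_cancel₀ _ hμ.ne']
    linarith
  have hquad : ‖W.U * W.Vᵀ‖ ≤ (ρ * e + ‖ξ‖ / μ) ^ 2 / (2 * (sigma r M - e)) := by
    have h1 := frobenius_norm_mul W.U W.Vᵀ
    rw [frobenius_norm_transpose] at h1
    have h2 := hW.mul_normSq_le hweyl hgU hgV
    have h3 := pow_le_pow_left₀ (norm_nonneg _) hLW 2
    have h4 : ‖W.U * W.Vᵀ‖ * 2 ≤ W.normSq := by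
      rw [Factors.normSq]
      nlinarith [sq_nonneg (‖W.U‖ - ‖W.V‖)]
    have h5 : 0 < sigma r M - e := sub_pos.2 hX
    rw [le_div_iff₀ (by positivity)]
    nlinarith
  have hsplit : (Z.U + W.U) * (Z.V + W.V)ᵀ - M =
      (tangent Z W - (G - F)) - F + W.U * W.Vᵀ := by
    have : Z.toMatrix = M - G := by rw [hZX, hGdef, sub_sub_cancel]
    rw [Factors.toMatrix] at this
    rw [transpose_add, Matrix.add_mul, Matrix.mul_add, Matrix.mul_add, this, tangent]
    abel
  rw [hsplit]
  refine (norm_add_le _ _).trans (add_le_add ((norm_sub_le _ _).trans ?_) hquad)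
  linarith

/-- The constants: with `c = 7 ρ³` the radius `σ / c` gives `f ≤ 7 e² / (13 σ)` and
`σ - e ≥ 6 σ / 7`, and `14 / 13 + 7 / 12 ≤ 7 / 4`. -/
theorem step_bound_le {ρ σ e η f : ℝ} (hρ : 1 ≤ ρ) (hσ : 0 < σ) (he : 0 ≤ e) (hη : 0 ≤ η)
    (heσ : e ≤ σ / (7 * ρ ^ 3)) (hησ : η ≤ σ / (6 * (7 * ρ ^ 3))) (hf : 0 ≤ f) (hfe : f ≤ e)
    (hfq : 2 * σ * f ≤ e ^ 2 + f ^ 2) :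
    (1 + ρ) * f + η + (ρ * e + η) ^ 2 / (2 * (σ - e)) ≤ 7 * ρ ^ 3 / (4 * σ) * e ^ 2 + 3 * η := by
  have hρ2 : 1 ≤ ρ ^ 2 := one_le_pow₀ hρ
  have hρ3 : ρ ≤ ρ ^ 3 := le_self_pow₀ hρ (by norm_num)
  have hρ23 : ρ ^ 2 ≤ ρ ^ 3 := pow_le_pow_right₀ hρ (by norm_num)
  rw [le_div_iff₀ (by positivity)] at heσ hησ
  have hρe : 7 * (ρ * e) ≤ σ := by nlinarith
  have he7 : 7 * e ≤ σ := by nlinarith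
  have hη42 : 42 * η ≤ σ := by nlinarith
  have hf2 : 13 * (σ * f) ≤ 7 * e ^ 2 := by nlinarith
  have h1 : (ρ * e + η) ^ 2 / (2 * (σ - e)) ≤ (ρ * e + η) ^ 2 * 7 / (12 * σ) := by
    rw [div_le_div_iff₀ (by linarith) (by positivity)]
    nlinarith [sq_nonneg (ρ * e + η)]
  refine (add_le_add_right h1 _).trans ?_
  rw [← mul_le_mul_iff_right₀ hσ]
  have e1 : σ * ((1 + ρ) * f + η + (ρ * e + η) ^ 2 * 7 / (12 * σ)) =
      (1 + ρ) * (σ * f) + σ * η + 7 / 12 * (ρ * e + η) ^ 2 := by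
    field_simp
  have e2 : σ * (7 * ρ ^ 3 / (4 * σ) * e ^ 2 + 3 * η) = 7 / 4 * (ρ ^ 3 * e ^ 2) + 3 * (σ * η) := by
    field_simp
  rw [e1, e2]
  have b1 : (1 + ρ) * (σ * f) ≤ 14 / 13 * (ρ ^ 3 * e ^ 2) := by
    have : (1 + ρ) * (σ * f) ≤ 2 * ρ * (σ * f) := by
      have := mul_nonneg hσ.le hf
      gcongr; linarith
    have h2 : 2 * ρ * (13 * (σ * f)) ≤ 2 * ρ * (7 * e ^ 2) := by gcongr
    have h3 : ρ * e ^ 2 ≤ ρ ^ 3 * e ^ 2 := by gcongr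
    linarith
  have b2 : (ρ * e) ^ 2 ≤ ρ ^ 3 * e ^ 2 := by rw [mul_pow]; gcongr
  have b3 : 7 * (ρ * e) * η ≤ σ * η := by gcongr
  have b4 : 42 * η * η ≤ σ * η := by gcongr
  have b5 : 0 ≤ σ * η := by positivity
  have b6 : 0 ≤ ρ ^ 3 * e ^ 2 := by positivity
  nlinarith

/-! ### From one step to the whole run -/

theorem IsRun.toMatrix_succ {A : Matrix (Fin n₁) (Fin n₂) ℝ →ₗ[ℝ] EuclideanSpace ℝ (Fin m)}
    {b : EuclideanSpace ℝ (Fin m)} {Z₀ : Factors n₁ n₂ r} {Z' Z W : ℕ → Factors n₁ n₂ r}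
    (h : IsRun A b (-1) Z₀ Z' Z W) (t : ℕ) :
    (Z (t + 1)).toMatrix = ((Z t).U + (W t).U) * ((Z t).V + (W t).V)ᵀ := by
  rw [(h.balance (t + 1)).toMatrix_eq, Factors.toMatrix, h.update_U, h.update_V]
  norm_num

theorem SatisfiesRIP.sqrt_bounds {A : Matrix (Fin n₁) (Fin n₂) ℝ →ₗ[ℝ] EuclideanSpace ℝ (Fin m)}
    {k : ℕ} {δ' δ : ℝ} (h : SatisfiesRIP A k δ') (hδ : δ' ≤ δ) (hδ1 : δ < 1)
    {N : Matrix (Fin n₁) (Fin n₂) ℝ} (hN : N.rank ≤ k) :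
    √(1 - δ) * ‖N‖ ≤ ‖A N‖ ∧ ‖A N‖ ≤ √(1 + δ) * ‖N‖ := by
  obtain ⟨h1, h2⟩ := h.bounds N hN
  have h0 := h.nonneg
  constructor
  · refine le_of_sq_le_sq ?_ (norm_nonneg _)
    rw [mul_pow, Real.sq_sqrt (by linarith)]
    refine le_trans ?_ h1
    gcongr
  · refine le_of_sq_le_sq ?_ (by positivity)
    rw [mul_pow, Real.sq_sqrt (by linarith)]
    refine h2.trans ?_
    gcongr

/-- In the scaled quantities `x = c e / σ` and `h = c η / σ`, the recursion keeps
`x ≤ y + 6 h` when `y` becomes `y² / 4`. -/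
theorem sq_div_four_add_le {x y h : ℝ} (hx0 : 0 ≤ x) (hx1 : x ≤ 1) (hy : 0 ≤ y) (hh : 0 ≤ h)
    (hxy : x ≤ y + 6 * h) : x ^ 2 / 4 + 3 * h ≤ y ^ 2 / 4 + 6 * h := by
  rcases le_total x y with hle | hle
  · nlinarith
  · nlinarith

theorem quadratic_recursion_bounds {c σ η : ℝ} (hc : 0 < c) (hσ : 0 < σ) (hη : 0 ≤ η)
    (hησ : η ≤ σ / (6 * c)) {e : ℕ → ℝ} (he : ∀ t, 0 ≤ e t) (he0 : e 0 ≤ σ / c)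
    (hstep : ∀ t, e t ≤ σ / c → e (t + 1) ≤ c / (4 * σ) * e t ^ 2 + 3 * η) :
    ∀ t, e t ≤ σ / c ∧ e t ≤ σ / (4 ^ (2 ^ t - 1) * c) + 6 * η := by
  have hh : 0 ≤ c * η / σ := by positivity
  have hh6 : c * η / σ ≤ 1 / 6 := by
    rw [le_div_iff₀ (by positivity)] at hησ
    rw [div_le_iff₀ hσ]; linarith
  intro t
  induction t with
  | zero => exact ⟨he0, by simpa using he0.trans (le_add_of_nonneg_right (by positivity))⟩
  | succ t ih =>
    obtain ⟨ih1, ih2⟩ := ih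
    have hs := hstep t ih1
    set y : ℝ := 1 / 4 ^ (2 ^ t - 1) with hy
    have hy' : 1 / (4 : ℝ) ^ (2 ^ (t + 1) - 1) = y ^ 2 / 4 := by
      have : 2 ^ (t + 1) - 1 = (2 ^ t - 1) * 2 + 1 := by
        have := Nat.one_le_two_pow (n := t)
        rw [pow_succ]; omega
      rw [this, pow_succ, pow_mul, hy]
      field_simp
    have scale : ∀ z : ℝ, z = c * z / σ * (σ / c) := fun z => by field_simp
    have hx1 : c * e t / σ ≤ 1 := by
      rw [le_div_iff₀ hc] at ih1
      rw [div_le_one hσ]; linarith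
    have hx0 : 0 ≤ c * e t / σ := by have := he t; positivity
    have hs' : c * e (t + 1) / σ ≤ (c * e t / σ) ^ 2 / 4 + 3 * (c * η / σ) := by
      have : (c * e t / σ) ^ 2 / 4 + 3 * (c * η / σ) =
          c * (c / (4 * σ) * e t ^ 2 + 3 * η) / σ := by field_simp
      rw [this]; gcongr
    have hxy : c * e t / σ ≤ y + 6 * (c * η / σ) := by
      have : y + 6 * (c * η / σ) = c * (σ / (4 ^ (2 ^ t - 1) * c) + 6 * η) / σ := by
        rw [hy]; field_simp
      rw [this]; gcongr
    constructor
    · have : c * e (t + 1) / σ ≤ 1 := by nlinarith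
      rw [div_le_one hσ] at this
      rw [le_div_iff₀ hc]; linarith
    · have h1 := hs'.trans (sq_div_four_add_le hx0 hx1 (by positivity) hh hxy)
      rw [← hy'] at h1
      calc e (t + 1) = c * e (t + 1) / σ * (σ / c) := scale _
        _ ≤ (1 / 4 ^ (2 ^ (t + 1) - 1) + 6 * (c * η / σ)) * (σ / c) := by gcongr
        _ = σ / (4 ^ (2 ^ (t + 1) - 1) * c) + 6 * η := by field_simp

theorem tendsto_double_exponential_bound (σ c d : ℝ) :
    Filter.Tendsto (fun t : ℕ => σ / (4 ^ (2 ^ t - 1) * c) + d) Filter.atTop (nhds d) := by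
  have hexp : Filter.Tendsto (fun t : ℕ => 2 ^ t - 1) Filter.atTop Filter.atTop :=
    Filter.tendsto_atTop_mono (fun t => Nat.le_pred_of_lt Nat.lt_two_pow_self) Filter.tendsto_id
  have h4 : Filter.Tendsto (fun t : ℕ => ((1 / 4 : ℝ)) ^ (2 ^ t - 1)) Filter.atTop (nhds 0) :=
    (tendsto_pow_atTop_nhds_zero_of_lt_one (by norm_num) (by norm_num)).comp hexp
  have h := (h4.const_mul (σ / c)).add_const d
  rw [mul_zero, zero_add] at h
  refine h.congr fun t => ?_
  rw [one_div, inv_pow, ← div_eq_mul_inv, div_div, mul_comm c]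

end GNMR

theorem theorem2 {n₁ n₂ m r : ℕ} (hr : 1 ≤ r)
    (δ : ℝ) (hδ0 : 0 < δ) (hδ1 : δ < 1)
    (c : ℝ) (hc : c = 7 * (1 + δ) ^ (3 / 2 : ℝ) / (1 - δ) ^ (3 / 2 : ℝ))
    (A : Matrix (Fin n₁) (Fin n₂) ℝ →ₗ[ℝ] EuclideanSpace ℝ (Fin m))
    (δ2r : ℝ) (hRIP : GNMR.SatisfiesRIP A (2 * r) δ2r) (hδ2r : δ2r ≤ δ)
    (Xstar : Matrix (Fin n₁) (Fin n₂) ℝ) (hrank : Xstar.rank = r)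
    (ξ b : EuclideanSpace ℝ (Fin m)) (hb : b = A Xstar + ξ)
    (hξ : ‖ξ‖ ≤ GNMR.sigma r Xstar * √(1 - δ) / (6 * c))
    (Z₀ : GNMR.Factors n₁ n₂ r) (hZ₀ : Z₀ ∈ GNMR.Berr r Xstar (1 / c))
    (Z' Z W : ℕ → GNMR.Factors n₁ n₂ r) (hrun : GNMR.IsRun A b (-1) Z₀ Z' Z W) :
    (∀ t : ℕ, ‖(Z (t + 1)).toMatrix - Xstar‖ ≤
        c / (4 * GNMR.sigma r Xstar) * ‖(Z t).toMatrix - Xstar‖ ^ 2 + 3 * ‖ξ‖ / √(1 - δ)) ∧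
    (∀ t : ℕ, ‖(Z t).toMatrix - Xstar‖ ≤
        GNMR.sigma r Xstar / (4 ^ (2 ^ t - 1) * c) + 6 * ‖ξ‖ / √(1 - δ)) ∧
    Filter.Tendsto
      (fun t : ℕ => GNMR.sigma r Xstar / (4 ^ (2 ^ t - 1) * c) + 6 * ‖ξ‖ / √(1 - δ))
      Filter.atTop (nhds (6 * ‖ξ‖ / √(1 - δ))) := by
  have hm : 0 < √(1 - δ) := Real.sqrt_pos.2 (by linarith)
  set ρ := √(1 + δ) / √(1 - δ) with hρ
  have hρ1 : 1 ≤ ρ := (one_le_div hm).2 (Real.sqrt_le_sqrt (by linarith))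
  have hcρ : c = 7 * ρ ^ 3 := by
    have hpow : ∀ x : ℝ, 0 ≤ x → x ^ (3 / 2 : ℝ) = √x ^ 3 := fun x hx => by
      rw [Real.sqrt_eq_rpow, ← Real.rpow_mul_natCast hx]
      norm_num
    rw [hc, hpow _ (by linarith), hpow _ (by linarith), hρ, div_pow, mul_div_assoc]
  have hc0 : 0 < c := by rw [hcρ]; positivity
  have hσ : 0 < GNMR.sigma r Xstar := Matrix.sigma_pos hr hrank
  have hη : ‖ξ‖ / √(1 - δ) ≤ GNMR.sigma r Xstar / (6 * c) := by
    rw [div_le_iff₀ hm]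
    exact hξ.trans_eq (by ring)
  have hcσ : GNMR.sigma r Xstar / c < GNMR.sigma r Xstar := by
    refine div_lt_self hσ ?_
    rw [hcρ]
    nlinarith [one_le_pow₀ (n := 3) hρ1]
  have hstep : ∀ t, ‖(Z t).toMatrix - Xstar‖ ≤ GNMR.sigma r Xstar / c →
      ‖(Z (t + 1)).toMatrix - Xstar‖ ≤
        c / (4 * GNMR.sigma r Xstar) * ‖(Z t).toMatrix - Xstar‖ ^ 2 + 3 * (‖ξ‖ / √(1 - δ)) := by
    intro t ht
    have hbal := hrun.balance t
    rw [← hbal.toMatrix_eq] at hbal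
    have hsol := hrun.solve t
    rw [hb] at hsol
    obtain ⟨f, hf0, hfe, hfq, hle⟩ := hsol.step_le (ρ := ρ) hm
      (fun N hN => (hRIP.sqrt_bounds hδ2r hδ1 hN).1)
      (fun N hN => by
        rw [hρ, div_mul_cancel₀ _ hm.ne']
        exact (hRIP.sqrt_bounds hδ2r hδ1 hN).2)
      hrank hbal (ht.trans_lt hcσ)
    rw [hrun.toMatrix_succ, hcρ]
    exact hle.trans (GNMR.step_bound_le hρ1 hσ (norm_nonneg _) (by positivity) (hcρ ▸ ht)
      (hcρ ▸ hη) hf0 hfe hfq)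
  have hinit : ‖(Z 0).toMatrix - Xstar‖ ≤ GNMR.sigma r Xstar / c := by
    rw [(hrun.balance 0).toMatrix_eq, hrun.init]
    exact le_of_le_of_eq hZ₀ (one_div_mul_eq_div _ _)
  have hall := GNMR.quadratic_recursion_bounds hc0 hσ (by positivity) hη
    (fun t => norm_nonneg ((Z t).toMatrix - Xstar)) hinit hstep
  simp only [mul_div_assoc 3 ‖ξ‖, mul_div_assoc 6 ‖ξ‖]
  exact ⟨fun t => hstep t (hall t).1, fun t => (hall t).2,
    GNMR.tendsto_double_exponential_bound _ _ _⟩
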